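/- Let $\mathcal G$ be a finitely generated group with unit $e$, and let $\mathbf p=(p_g)_{g\in\mathcal G}$ be a finitely supported probability vector on $\mathcal G$. Let $\mathcal P_{\mathbf p}=\sum_{g} p_g\,\lambda(g)$, where $\lambda(g)(h)=gh$, be the transition kernel of the random walk on $\mathcal G$ that jumps from $h$ to $gh$ with probability $p_g$, and let $$\mathfrak h(\mathbf p)=\lim_{t\to\infty}-\frac1t\sum_{g\in\mathcal G}\mathcal P_{\mathbf p}^t(e,g)\log\mathcal P_{\mathbf p}^t(e,g)$$ be its entropy rate (with $0\log 0=0$; the limit exists). Assume that $\mathfrak h(\mathbf p)>0$. Let $I\subseteq\mathbb N$ be infinite (for instance $I=\mathbb N$) and, for each $n\in I$, let $V_n$ be a set with $\#V_n=n$ on which $\mathcal G$ acts by $\varphi_n:\mathcal G\times V_n\to V_n$. Let $P_{n,\mathbf p}=\sum_g p_g S_g$ be the transition matrix of the random walk on $V_n$ that jumps from $x$ to $\varphi_n(g,x)$ with probability $p_g$, where $S_g$ is the permutation matrix of $x\mapsto\varphi_n(g,x)$, and let $\pi_n$ be the uniform probability measure on $V_n$. For $x\in V_n$ and $\delta\in(0,1)$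 let $$T^{\mathrm{mix}}_{n,\mathbf p}(x,\delta)=\inf\Big\{t\in\mathbb N:\ \|P^t_{n,\mathbf p}(x,\cdot)-\pi_n\|_{\mathrm{TV}}<\delta\Big\}\in\mathbb N\cup\{\infty\},\qquad \|\mu-\pi_n\|_{\mathrm{TV}}=\frac12\sum_{y\in V_n}|\mu(y)-\pi_n(y)|,$$ with $\inf\emptyset=\infty$. Then for every $\varepsilon\in(0,1)$, $$\liminf_{n\to\infty,\ n\in I}\ \min_{x\in V_n}\frac{T^{\mathrm{mix}}_{n,\mathbf p}(x,1-\varepsilon)}{\log n}\ \ge\ \frac1{\mathfrak h(\mathbf p)}.$$ -/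

import Mathlib

open Filter Topology
open scoped ENNReal

universe u v

namespace EntropicBound

noncomputable section

/-! ### The random walk on the group -/

section GroupWalk

variable {G : Type u} [Group G]

/-- The left multiplication operator `λ(g)` on finitely supported functions,
`λ(g) δ_h = δ_{g h}`. -/
def leftMul (g : G) : Module.End ℝ (G →₀ ℝ) := Finsupp.lmapDomain ℝ ℝ (fun h => g * h)

/-- The transition operator `𝒫_p = ∑ g, p g • λ(g)` on finitely supported functions. The walk
jumps from `h` to `g h` with probability `p g`. -/
def walkOperator (p : G →₀ ℝ) : Module.End ℝ (G →₀ ℝ) :=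
  ∑ g ∈ p.support, p g • leftMul g

/-- The `t`-step transition probability `𝒫_p ^ t (x, y)`: the mass at `y` of the law at time `t` of
the walk started at `x`. -/
def walkProb (p : G →₀ ℝ) (t : ℕ) (x y : G) : ℝ :=
  ((walkOperator p ^ t) (Finsupp.single x 1)) y

/-- The Shannon entropy `-∑ g, 𝒫_p ^ t (e, g) log 𝒫_p ^ t (e, g)` of the walk at time `t`, started
at the unit `e`. Only finitely many terms are nonzero, so the sum is finite. -/
def walkEntropy (p : G →₀ ℝ) (t : ℕ) : ℝ :=
  -∑ᶠ g : G, walkProb p t 1 g * Real.log (walkProb p t 1 g)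

/-- The entropy rate `𝔥(p) = lim_{t → ∞} (1 / t) H(𝒫_p ^ t (e, ·))`. The limit exists for every
finitely supported probability vector, see `tendsto_entropyRate`. -/
def entropyRate (p : G →₀ ℝ) : ℝ :=
  limUnder atTop fun t : ℕ => (1 / (t : ℝ)) * walkEntropy p t

end GroupWalk

/-! ### The random walk on a finite set on which the group acts -/

section FiniteWalk

variable {G : Type u} [Group G] {V : Type v} [Fintype V] [DecidableEq V] [MulAction G V]

/-- The transition matrix `P_p = ∑ g, p g • S_g`, where `S_g` is the permutation matrix of
`x ↦ g • x`: its entry at `(x, y)` is `1` if `y = g • x` and `0` otherwise. -/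
def actionMatrix (V : Type v) [Fintype V] [DecidableEq V] [MulAction G V] (p : G →₀ ℝ) :
    Matrix V V ℝ :=
  ∑ g ∈ p.support, p g • (MulAction.toPerm g : Equiv.Perm V).permMatrix ℝ

/-- The total variation distance `‖P_p ^ t (x, ·) - π‖_TV` to the uniform measure `π` on `V`. -/
def distToUniform (p : G →₀ ℝ) (x : V) (t : ℕ) : ℝ :=
  (1 / 2) * ∑ y : V, |(actionMatrix V p ^ t) x y - 1 / (Fintype.card V : ℝ)|

/-- The mixing time `inf {t ∈ ℕ : ‖P_p ^ t (x, ·) - π‖_TV < δ}` started at `x`, which is `⊤` if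
there is no such `t`. -/
def mixingTime (p : G →₀ ℝ) (x : V) (δ : ℝ) : ℕ∞ :=
  ⨅ (t : ℕ) (_ : distToUniform p x t < δ), (t : ℕ∞)

end FiniteWalk

/-! ### Existence of the entropy rate -/

section Existence

variable {G : Type u} [Group G]

theorem leftMul_single (g h : G) (r : ℝ) :
    leftMul g (Finsupp.single h r) = Finsupp.single (g * h) r := by
  simp [leftMul, Finsupp.mapDomain_single]

theorem leftMul_one : leftMul (1 : G) = 1 := by
  ext; simp [leftMul_single]

theorem leftMul_mul (g h : G) : leftMul (g * h) = leftMul g * leftMul h := by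
  ext; simp [leftMul_single, mul_assoc]

/-- The law of the walk at time `t`. -/
def walkLaw (p : G →₀ ℝ) (t : ℕ) : G →₀ ℝ := (walkOperator p ^ t) (Finsupp.single 1 1)

/-- Linear extension of the left regular representation. -/
def conv : (G →₀ ℝ) →ₗ[ℝ] Module.End ℝ (G →₀ ℝ) :=
  Finsupp.linearCombination ℝ (fun g : G => leftMul g)

theorem conv_single (g : G) (r : ℝ) : conv (Finsupp.single g r) = r • leftMul g := by
  simp [conv]

theorem conv_eq (p : G →₀ ℝ) : conv p = walkOperator p := by
  simp [conv, walkOperator, Finsupp.linearCombination_apply, Finsupp.sum]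

theorem conv_conv (a b : G →₀ ℝ) : conv (conv a b) = conv a * conv b := by
  induction a using Finsupp.induction_linear with
  | zero => simp
  | add a₁ a₂ h₁ h₂ => simp [h₁, h₂, add_mul]
  | single g r =>
    induction b using Finsupp.induction_linear with
    | zero => simp
    | add b₁ b₂ h₁ h₂ => simp only [map_add, h₁, h₂, mul_add]
    | single h s =>
      simp only [conv_single, LinearMap.smul_apply, map_smul, leftMul_single, leftMul_mul,
        smul_mul_assoc, mul_smul_comm]
      rw [smul_comm]

theorem conv_walkLaw (p : G →₀ ℝ) (t : ℕ) : conv (walkLaw p t) = walkOperator p ^ t := by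
  induction t with
  | zero => simp [walkLaw, conv_single, leftMul_one]
  | succ t ih =>
    have : walkLaw p (t + 1) = conv p (walkLaw p t) := by
      rw [conv_eq]; simp [walkLaw, pow_succ']
    rw [this, conv_conv, ih, conv_eq, pow_succ']

theorem walkLaw_add (p : G →₀ ℝ) (s t : ℕ) :
    walkLaw p (s + t) = conv (walkLaw p s) (walkLaw p t) := by
  rw [conv_walkLaw]; simp [walkLaw, pow_add]

theorem walkLaw_succ (p : G →₀ ℝ) (t : ℕ) : walkLaw p (t + 1) = conv p (walkLaw p t) := by
  rw [conv_eq]; simp [walkLaw, pow_succ']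

open Classical in
theorem conv_apply (a b : G →₀ ℝ) (k : G) :
    conv a b k = ∑ x ∈ a.support ×ˢ b.support, if x.1 * x.2 = k then a x.1 * b x.2 else 0 := by
  conv_lhs => rw [← Finsupp.sum_single b]
  simp only [conv, Finsupp.linearCombination_apply, Finsupp.sum, LinearMap.sum_apply,
    LinearMap.smul_apply, map_sum, Finsupp.finsetSum_apply, Finsupp.smul_apply, smul_eq_mul,
    leftMul_single, Finset.sum_product, Finsupp.single_apply]
  rw [Finset.sum_comm]
  simp only [mul_ite, mul_zero]

theorem walkLaw_nonneg {p : G →₀ ℝ} (hp : ∀ g, 0 ≤ p g) (t : ℕ) (g : G) :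
    0 ≤ walkLaw p t g := by
  classical
  induction t generalizing g with
  | zero =>
    simp only [walkLaw, pow_zero, Module.End.one_apply, Finsupp.single_apply]
    split_ifs <;> norm_num
  | succ t ih =>
    rw [walkLaw_succ, conv_apply]
    refine Finset.sum_nonneg fun x _ => ?_
    split_ifs
    · exact mul_nonneg (hp _) (ih _)
    · exact le_rfl

open Classical in
theorem support_conv (a b : G →₀ ℝ) :
    (conv a b).support ⊆ (a.support ×ˢ b.support).image fun x => x.1 * x.2 := by
  intro k hk
  rw [Finsupp.mem_support_iff, conv_apply] at hk
  obtain ⟨x, hx, hxk⟩ := Finset.exists_ne_zero_of_sum_ne_zero hk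
  refine Finset.mem_image.2 ⟨x, hx, ?_⟩
  by_contra h
  exact hxk (if_neg h)

theorem sum_conv (a b : G →₀ ℝ) :
    ∑ k ∈ (conv a b).support, conv a b k
      = (∑ g ∈ a.support, a g) * ∑ h ∈ b.support, b h := by
  classical
  rw [Finset.sum_subset (support_conv a b) (fun k _ hk => Finsupp.notMem_support_iff.1 hk)]
  simp only [conv_apply]
  rw [Finset.sum_comm, Finset.sum_mul_sum, ← Finset.sum_product'
      (f := fun g h => a g * b h)]
  refine Finset.sum_congr rfl fun x hx => ?_
  rw [Finset.sum_ite_eq, if_pos (Finset.mem_image_of_mem _ hx)]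

theorem walkLaw_sum {p : G →₀ ℝ} (hp : ∑ g ∈ p.support, p g = 1) (t : ℕ) :
    ∑ g ∈ (walkLaw p t).support, walkLaw p t g = 1 := by
  induction t with
  | zero => simp [walkLaw]
  | succ t ih => rw [walkLaw_succ, sum_conv, hp, ih, one_mul]

theorem walkEntropy_eq (p : G →₀ ℝ) (t : ℕ) (s : Finset G) (hs : (walkLaw p t).support ⊆ s) :
    walkEntropy p t = ∑ g ∈ s, Real.negMulLog (walkLaw p t g) := by
  have h : walkEntropy p t = -∑ᶠ g : G, walkLaw p t g * Real.log (walkLaw p t g) := rfl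
  rw [h, finsum_eq_sum_of_support_subset (s := s), ← Finset.sum_neg_distrib]
  · simp [Real.negMulLog]
  · intro g hg
    refine hs (Finsupp.mem_support_iff.2 fun h0 => hg ?_)
    simp [h0]

theorem negMulLog_sum_le {ι : Type*} (s : Finset ι) (f : ι → ℝ) (hf : ∀ i ∈ s, 0 ≤ f i) :
    Real.negMulLog (∑ i ∈ s, f i) ≤ ∑ i ∈ s, Real.negMulLog (f i) := by
  simp only [Real.negMulLog, Finset.sum_neg_distrib, neg_mul]
  rw [neg_le_neg_iff, Finset.sum_mul]
  refine Finset.sum_le_sum fun i hi => ?_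
  rcases (hf i hi).eq_or_lt with h | h
  · simp [← h]
  · exact mul_le_mul_of_nonneg_left (Real.log_le_log h (Finset.single_le_sum hf hi)) h.le

theorem walkEntropy_add_le {p : G →₀ ℝ} (hp : ∀ g, 0 ≤ p g) (hp1 : ∑ g ∈ p.support, p g = 1)
    (s t : ℕ) : walkEntropy p (s + t) ≤ walkEntropy p s + walkEntropy p t := by
  classical
  set a := walkLaw p s with ha
  set b := walkLaw p t with hb
  have hab : walkLaw p (s + t) = conv a b := walkLaw_add p s t
  rw [walkEntropy_eq p (s + t) _ (hab ▸ support_conv a b), walkEntropy_eq p s _ subset_rfl,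
    walkEntropy_eq p t _ subset_rfl, hab]
  calc _ ≤ ∑ k ∈ (a.support ×ˢ b.support).image (fun x => x.1 * x.2),
          ∑ x ∈ a.support ×ˢ b.support,
            if x.1 * x.2 = k then Real.negMulLog (a x.1 * b x.2) else 0 := by
        refine Finset.sum_le_sum fun k _ => ?_
        rw [conv_apply]
        refine (negMulLog_sum_le _ _ fun x _ => ?_).trans_eq ?_
        · split_ifs
          · exact mul_nonneg (walkLaw_nonneg hp _ _) (walkLaw_nonneg hp _ _)
          · exact le_rfl
        · refine Finset.sum_congr rfl fun x _ => ?_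
          split_ifs <;> simp
    _ = ∑ x ∈ a.support ×ˢ b.support, Real.negMulLog (a x.1 * b x.2) := by
        rw [Finset.sum_comm]
        refine Finset.sum_congr rfl fun x hx => ?_
        rw [Finset.sum_ite_eq, if_pos (Finset.mem_image_of_mem _ hx)]
    _ = (∑ h ∈ b.support, b h) * (∑ g ∈ a.support, Real.negMulLog (a g))
        + (∑ g ∈ a.support, a g) * ∑ h ∈ b.support, Real.negMulLog (b h) := by
        simp only [Real.negMulLog_mul, Finset.sum_add_distrib]
        rw [Finset.sum_mul_sum, Finset.sum_mul_sum, Finset.sum_product_right, Finset.sum_product]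
    _ = _ := by rw [walkLaw_sum hp1, walkLaw_sum hp1, one_mul, one_mul]

theorem walkEntropy_nonneg {p : G →₀ ℝ} (hp : ∀ g, 0 ≤ p g) (hp1 : ∑ g ∈ p.support, p g = 1)
    (t : ℕ) : 0 ≤ walkEntropy p t := by
  rw [walkEntropy_eq p t _ subset_rfl]
  refine Finset.sum_nonneg fun g hg => Real.negMulLog_nonneg (walkLaw_nonneg hp t g) ?_
  exact (Finset.single_le_sum (fun i _ => walkLaw_nonneg hp t i) hg).trans_eq (walkLaw_sum hp1 t)

/-- The limit which defines the entropy rate exists. -/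
theorem tendsto_entropyRate {p : G →₀ ℝ} (hp : ∀ g, 0 ≤ p g)
    (hp1 : ∑ g ∈ p.support, p g = 1) :
    Tendsto (fun t : ℕ => (1 / (t : ℝ)) * walkEntropy p t) atTop (𝓝 (entropyRate p)) := by
  have hsub : Subadditive (walkEntropy p) := fun s t => walkEntropy_add_le hp hp1 s t
  have hlim := hsub.tendsto_lim ⟨0, by
    rintro _ ⟨t, rfl⟩
    exact div_nonneg (walkEntropy_nonneg hp hp1 t) (Nat.cast_nonneg t)⟩
  refine tendsto_nhds_limUnder ⟨hsub.lim, hlim.congr fun t => ?_⟩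
  ring

end Existence

end

end EntropicBound

/-! The law on `V n` at time `t` is the image of the law on `G` under `g ↦ g • x`. Its total
variation distance to uniform is one minus the overlap `∑ y, min (μ y) (1 / n)`, and `min a b ≤ a ^
(1 - s) * b ^ s` bounds the overlap by `n ^ (-s) * ∑ y, μ y ^ (1 - s)`. Merging atoms only lowers
such a power sum, so the one on `G` serves for every action and every starting point
(`one_sub_le_distToUniform`).

Power sums are submultiplicative under convolution, and the derivative of `∑ g, a g ^ (1 - s)` at `s
= 0` is the entropy of `a`. Hence, for `h` above the entropy rate, one time `k` with entropy below
`k * h` and one small `s` give `O (exp (s * t * h))` for all `t` (`exists_powerSum_walkLaw_le`). If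
`t ≤ c * log n` with `c * h < 1`, the overlap is `O (n ^ (-s * (1 - c * h)))`, which tends to `0`.
No concentration of the information content is needed. -/

namespace EntropicBound

/-! ### Power sums, total variation and entropy -/

section PowerSums

/-- Subadditivity of `x ↦ x ^ r` for `0 < r ≤ 1`, for finite sums. -/
theorem sum_rpow_le {ι : Type*} (s : Finset ι) (f : ι → ℝ) (hf : ∀ i ∈ s, 0 ≤ f i) {r : ℝ}
    (hr : 0 < r) (hr1 : r ≤ 1) : (∑ i ∈ s, f i) ^ r ≤ ∑ i ∈ s, f i ^ r :=
  Finset.le_sum_of_subadditive_on_pred (fun x : ℝ => x ^ r) (fun x => 0 ≤ x)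
    (Real.zero_rpow hr.ne').le (fun _ _ hx hy => Real.rpow_add_le_add_rpow hx hy hr.le hr1)
    (fun _ _ hx hy => add_nonneg hx hy) f hf

/-- Pushing a finite measure forward does not increase the sum of the `r`-th powers of its
masses. -/
theorem sum_rpow_fiber_le {ι κ : Type*} [DecidableEq κ] (S : Finset ι) (T : Finset κ)
    (φ : ι → κ) (w : ι → ℝ) (hw : ∀ i ∈ S, 0 ≤ w i) {r : ℝ} (hr : 0 < r) (hr1 : r ≤ 1) :
    ∑ k ∈ T, (∑ i ∈ S, if φ i = k then w i else 0) ^ r ≤ ∑ i ∈ S, w i ^ r := by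
  calc _ ≤ ∑ k ∈ T, ∑ i ∈ S, if φ i = k then w i ^ r else 0 := by
        refine Finset.sum_le_sum fun k _ => ?_
        refine (sum_rpow_le _ _ (fun i hi => ?_) hr hr1).trans_eq ?_
        · split_ifs
          · exact hw i hi
          · exact le_rfl
        · refine Finset.sum_congr rfl fun i _ => ?_
          split_ifs
          · rfl
          · exact Real.zero_rpow hr.ne'
    _ ≤ _ := by
        rw [Finset.sum_comm]
        refine Finset.sum_le_sum fun i hi => ?_
        rw [Finset.sum_ite_eq]
        split_ifs
        · exact le_rfl
        · exact Real.rpow_nonneg (hw i hi) r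

theorem min_le_rpow_mul_rpow {a b s : ℝ} (ha : 0 ≤ a) (hb : 0 ≤ b) (hs : 0 ≤ s) (hs1 : s ≤ 1) :
    min a b ≤ a ^ (1 - s) * b ^ s := by
  have hm : 0 ≤ min a b := le_min ha hb
  calc min a b = min a b ^ (1 - s) * min a b ^ s := by
        rw [← Real.rpow_add_of_nonneg hm (by linarith) hs, sub_add_cancel, Real.rpow_one]
    _ ≤ _ := mul_le_mul (Real.rpow_le_rpow hm (min_le_left _ _) (by linarith))
        (Real.rpow_le_rpow hm (min_le_right _ _) hs) (Real.rpow_nonneg hm _)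
        (Real.rpow_nonneg ha _)

/-- A lower bound for the total variation distance of a probability vector to the uniform
distribution in terms of the sum of the powers of its masses. -/
theorem one_sub_le_half_sum_abs_sub {V : Type*} [Fintype V] [Nonempty V] (μ : V → ℝ)
    (hμ : ∀ y, 0 ≤ μ y) (hμ1 : ∑ y, μ y = 1) {s : ℝ} (hs : 0 ≤ s) (hs1 : s ≤ 1) :
    1 - (1 / (Fintype.card V : ℝ)) ^ s * ∑ y, μ y ^ (1 - s) ≤
      (1 / 2) * ∑ y, |μ y - 1 / (Fintype.card V : ℝ)| := by
  have hcard : (Fintype.card V : ℝ) ≠ 0 := by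
    exact_mod_cast Fintype.card_ne_zero
  have hle : ∑ y, (μ y + 1 / (Fintype.card V : ℝ)
        - 2 * ((1 / (Fintype.card V : ℝ)) ^ s * μ y ^ (1 - s)))
      ≤ ∑ y, |μ y - 1 / (Fintype.card V : ℝ)| := by
    -- Termwise, `|a - b| = a + b - 2 * min a b`.
    refine Finset.sum_le_sum fun y _ => ?_
    have hmin := min_le_rpow_mul_rpow (hμ y) (b := 1 / (Fintype.card V : ℝ)) (by positivity) hs hs1
    have := min_add_max (μ y) (1 / (Fintype.card V : ℝ))
    have := max_sub_min_eq_abs' (μ y) (1 / (Fintype.card V : ℝ))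
    linarith
  rw [Finset.sum_sub_distrib, Finset.sum_add_distrib, hμ1, ← Finset.mul_sum, ← Finset.mul_sum,
    Finset.sum_const, Finset.card_univ, nsmul_eq_mul, mul_one_div_cancel hcard] at hle
  linarith

/-- The sum of the `r`-th powers of the masses of a finitely supported function. -/
noncomputable def powerSum {G : Type*} (r : ℝ) (a : G →₀ ℝ) : ℝ := ∑ g ∈ a.support, a g ^ r

theorem powerSum_nonneg {G : Type*} (r : ℝ) {a : G →₀ ℝ}
    (ha : ∀ g, 0 ≤ a g) : 0 ≤ powerSum r a :=
  Finset.sum_nonneg fun g _ => Real.rpow_nonneg (ha g) r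

/-- The derivative of `s ↦ ∑ g, a g ^ (1 - s)` at `0` is the entropy of `a`, so this sum is at most
`exp (s c)` for some small `s > 0` as soon as `c` exceeds the entropy. -/
theorem exists_powerSum_le_exp {G : Type*} {a : G →₀ ℝ} (ha : ∀ g, 0 ≤ a g)
    (ha1 : ∑ g ∈ a.support, a g = 1) {c : ℝ}
    (hc : ∑ g ∈ a.support, Real.negMulLog (a g) < c) :
    ∃ s : ℝ, 0 < s ∧ s < 1 ∧ powerSum (1 - s) a ≤ Real.exp (s * c) := by
  -- The difference vanishes at `s = 0` because `a` has mass `1`, and its derivative there is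
  -- negative, so it is negative for small `s > 0`.
  have hderiv : HasDerivAt (fun s : ℝ => (∑ g ∈ a.support, a g ^ (1 - s)) - Real.exp (s * c))
      ((∑ g ∈ a.support, Real.negMulLog (a g)) - c) 0 := by
    refine HasDerivAt.sub (HasDerivAt.fun_sum fun g hg => ?_) ?_
    · have hpos : 0 < a g := (ha g).lt_of_ne' (Finsupp.mem_support_iff.1 hg)
      have h := ((hasDerivAt_id (0 : ℝ)).const_sub 1).const_rpow hpos
      simpa [Real.negMulLog, mul_comm] using h
    · simpa using ((hasDerivAt_id (0 : ℝ)).mul_const c).exp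
  have hev := (hasDerivAt_iff_tendsto_slope.1 hderiv).mono_left
    (nhdsWithin_mono 0 fun s (hs : s ∈ Set.Ioi 0) => ne_of_gt hs)
  have h1 := hev.eventually (gt_mem_nhds (sub_neg.2 hc))
  have h2 : ∀ᶠ s : ℝ in 𝓝[>] 0, s ∈ Set.Ioo (0 : ℝ) 1 := Ioo_mem_nhdsGT one_pos
  obtain ⟨s, hs, hs0, hs1⟩ := (h1.and h2).exists
  refine ⟨s, hs0, hs1, ?_⟩
  rw [slope_def_field] at hs
  have := (div_neg_iff.1 hs).resolve_left fun h => by linarith [h.2]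
  simp [ha1] at this
  exact this.1.le

end PowerSums

/-! ### Exponential growth of power sums along the walk -/

section GroupWalk

variable {G : Type u} [Group G]

/-- The convolution is the image of the product measure under multiplication, and power sums of
product measures factor. -/
theorem powerSum_conv_le {a b : G →₀ ℝ} (ha : ∀ g, 0 ≤ a g) (hb : ∀ g, 0 ≤ b g) {r : ℝ}
    (hr : 0 < r) (hr1 : r ≤ 1) : powerSum r (conv a b) ≤ powerSum r a * powerSum r b := by
  classical
  simp only [powerSum, conv_apply]
  refine (sum_rpow_fiber_le (a.support ×ˢ b.support) _ (fun x => x.1 * x.2)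
    (fun x => a x.1 * b x.2) (fun x _ => mul_nonneg (ha _) (hb _)) hr hr1).trans_eq ?_
  rw [Finset.sum_mul_sum, ← Finset.sum_product']
  exact Finset.sum_congr rfl fun x _ => Real.mul_rpow (ha _) (hb _)

theorem powerSum_walkLaw_add_le {p : G →₀ ℝ} (hp : ∀ g, 0 ≤ p g) {r : ℝ} (hr : 0 < r)
    (hr1 : r ≤ 1) (s t : ℕ) :
    powerSum r (walkLaw p (s + t)) ≤ powerSum r (walkLaw p s) * powerSum r (walkLaw p t) := by
  rw [walkLaw_add]
  exact powerSum_conv_le (walkLaw_nonneg hp s) (walkLaw_nonneg hp t) hr hr1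

theorem powerSum_walkLaw_mul_add_le {p : G →₀ ℝ} (hp : ∀ g, 0 ≤ p g) {r : ℝ} (hr : 0 < r)
    (hr1 : r ≤ 1) (k m j : ℕ) :
    powerSum r (walkLaw p (k * m + j)) ≤
      powerSum r (walkLaw p k) ^ m * powerSum r (walkLaw p j) := by
  induction m with
  | zero => simp
  | succ m ih =>
    rw [show k * (m + 1) + j = k + (k * m + j) by ring, pow_succ', mul_assoc]
    exact (powerSum_walkLaw_add_le hp hr hr1 _ _).trans
      (mul_le_mul_of_nonneg_left ih (powerSum_nonneg r (walkLaw_nonneg hp k)))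

/-- For every `h` above the entropy rate, some power sum of the law at time `t` is
`O (exp (s t h))`. -/
theorem exists_powerSum_walkLaw_le {p : G →₀ ℝ} (hp : ∀ g, 0 ≤ p g)
    (hp1 : ∑ g ∈ p.support, p g = 1) {h : ℝ} (hh : entropyRate p < h) (hh0 : 0 ≤ h) :
    ∃ s C : ℝ, 0 < s ∧ s < 1 ∧ 0 ≤ C ∧
      ∀ t : ℕ, powerSum (1 - s) (walkLaw p t) ≤ C * Real.exp (s * (t * h)) := by
  -- A single time `k` with entropy below `k * h` suffices; submultiplicativity extends the bound to
  -- all times.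
  obtain ⟨k, hk, hk0⟩ := (((tendsto_entropyRate hp hp1).eventually (gt_mem_nhds hh)).and
    (eventually_gt_atTop 0)).exists
  have hk0' : (0 : ℝ) < k := Nat.cast_pos.2 hk0
  rw [one_div_mul_eq_div, div_lt_iff₀ hk0', walkEntropy_eq p k _ subset_rfl] at hk
  obtain ⟨s, hs0, hs1, hs⟩ := exists_powerSum_le_exp (walkLaw_nonneg hp k) (walkLaw_sum hp1 k) hk
  have hnn : ∀ t, 0 ≤ powerSum (1 - s) (walkLaw p t) :=
    fun t => powerSum_nonneg _ (walkLaw_nonneg hp t)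
  -- The constant dominates the factor from the remainder `t % k`, whatever its value.
  refine ⟨s, ∑ j ∈ Finset.range k, powerSum (1 - s) (walkLaw p j), hs0, hs1,
    Finset.sum_nonneg fun j _ => hnn j, fun t => ?_⟩
  calc powerSum (1 - s) (walkLaw p t)
      = powerSum (1 - s) (walkLaw p (k * (t / k) + t % k)) := by rw [Nat.div_add_mod]
    _ ≤ powerSum (1 - s) (walkLaw p k) ^ (t / k) * powerSum (1 - s) (walkLaw p (t % k)) :=
        powerSum_walkLaw_mul_add_le hp (by linarith) (by linarith) _ _ _
    _ ≤ Real.exp (s * (t * h)) * ∑ j ∈ Finset.range k, powerSum (1 - s) (walkLaw p j) := by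
        refine mul_le_mul ?_ (Finset.single_le_sum (f := fun j => powerSum (1 - s) (walkLaw p j))
          (fun j _ => hnn j) (Finset.mem_range.2 (Nat.mod_lt t hk0))) (hnn _) (Real.exp_pos _).le
        refine (pow_le_pow_left₀ (hnn k) hs _).trans ?_
        rw [← Real.exp_nat_mul, Real.exp_le_exp]
        have hdiv : ((t / k : ℕ) : ℝ) * k ≤ t := by exact_mod_cast Nat.div_mul_le_self t k
        calc ((t / k : ℕ) : ℝ) * (s * (h * k)) = s * (((t / k : ℕ) : ℝ) * k * h) := by ring
          _ ≤ s * (t * h) :=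
            mul_le_mul_of_nonneg_left (mul_le_mul_of_nonneg_right hdiv hh0) hs0.le
    _ = _ := mul_comm _ _

end GroupWalk

/-! ### Transfer to the finite action -/

section FiniteWalk

variable {G : Type u} [Group G] {V : Type v} [Fintype V] [DecidableEq V] [MulAction G V]

theorem actionMatrix_apply (p : G →₀ ℝ) (x y : V) :
    actionMatrix V p x y = ∑ g ∈ p.support, if g • x = y then p g else 0 := by
  simp [actionMatrix, Matrix.sum_apply, Equiv.Perm.permMatrix, PEquiv.toMatrix_apply, eq_comm]

/-- The order is reversed: `(g * h) • x = g • (h • x)` moves by `h` first, and the first step is the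
left factor of a product of transition matrices. -/
theorem actionMatrix_conv (a b : G →₀ ℝ) :
    actionMatrix V (conv a b) = actionMatrix V b * actionMatrix V a := by
  classical
  ext x y
  rw [actionMatrix_apply, Finset.sum_subset (support_conv a b)
    (fun k _ hk => by simp [Finsupp.notMem_support_iff.1 hk])]
  simp only [Matrix.mul_apply, actionMatrix_apply, conv_apply, Finset.sum_mul_sum]
  calc _ = ∑ k ∈ (a.support ×ˢ b.support).image (fun x => x.1 * x.2),
          ∑ z ∈ a.support ×ˢ b.support,
            if z.1 * z.2 = k then (if (z.1 * z.2) • x = y then a z.1 * b z.2 else 0) else 0 := by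
        refine Finset.sum_congr rfl fun k _ => ?_
        split_ifs with hk
        · refine Finset.sum_congr rfl fun z _ => ?_
          split_ifs with h1 h2
          · rfl
          · exact absurd (h1 ▸ hk) h2
          · rfl
        · refine (Finset.sum_eq_zero fun z _ => ?_).symm
          split_ifs with h1 h2
          · exact absurd (h1 ▸ h2) hk
          · rfl
          · rfl
    _ = ∑ z ∈ a.support ×ˢ b.support, if (z.1 * z.2) • x = y then a z.1 * b z.2 else 0 := by
        rw [Finset.sum_comm]
        refine Finset.sum_congr rfl fun z hz => ?_
        rw [Finset.sum_ite_eq, if_pos (Finset.mem_image_of_mem _ hz)]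
    _ = _ := by
        rw [Finset.sum_comm, Finset.sum_product_right]
        refine Finset.sum_congr rfl fun h _ => ?_
        rw [Finset.sum_comm]
        refine Finset.sum_congr rfl fun g _ => ?_
        simp [ite_mul, mul_smul, mul_comm]

theorem actionMatrix_pow (p : G →₀ ℝ) (t : ℕ) :
    actionMatrix V p ^ t = actionMatrix V (walkLaw p t) := by
  induction t with
  | zero =>
    ext x y
    rw [actionMatrix_apply]
    simp [walkLaw, Matrix.one_apply]
  | succ t ih => rw [walkLaw_succ, actionMatrix_conv, ← ih, pow_succ]

/-- The total variation distance to the uniform measure is at least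
`1 - n ^ (-s) ∑ g, 𝒫_p ^ t (e, g) ^ (1 - s)`, where `n` is the number of points. -/
theorem one_sub_le_distToUniform {p : G →₀ ℝ} (hp : ∀ g, 0 ≤ p g)
    (hp1 : ∑ g ∈ p.support, p g = 1) (x : V) (t : ℕ) {s : ℝ} (hs : 0 ≤ s) (hs1 : s < 1) :
    1 - (1 / (Fintype.card V : ℝ)) ^ s * powerSum (1 - s) (walkLaw p t) ≤
      distToUniform p x t := by
  have : Nonempty V := ⟨x⟩
  have hnn := walkLaw_nonneg hp t
  have hle : ∑ y, (actionMatrix V p ^ t) x y ^ (1 - s) ≤ powerSum (1 - s) (walkLaw p t) := by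
    -- Row `x` is the image of `walkLaw p t` under the orbit map `g ↦ g • x`.
    simp only [actionMatrix_pow, actionMatrix_apply]
    exact sum_rpow_fiber_le _ _ (fun g : G => g • x) _ (fun g _ => hnn g) (by linarith)
      (by linarith)
  refine le_trans ?_ (one_sub_le_half_sum_abs_sub (fun y => (actionMatrix V p ^ t) x y)
    (fun y => ?_) ?_ hs hs1.le)
  · exact sub_le_sub_left (mul_le_mul_of_nonneg_left hle (by positivity)) 1
  · rw [actionMatrix_pow, actionMatrix_apply]
    refine Finset.sum_nonneg fun g _ => ?_
    split_ifs
    · exact hnn g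
    · exact le_rfl
  · simp only [actionMatrix_pow, actionMatrix_apply]
    rw [Finset.sum_comm]
    simpa using walkLaw_sum hp1 t

end FiniteWalk

end EntropicBound

/-! ### The lower bound on mixing times -/

theorem mainTheorem7 {G : Type u} [Group G] [Group.FG G]
    (p : G →₀ ℝ) (hp_nonneg : ∀ g, 0 ≤ p g) (hp_sum : ∑ g ∈ p.support, p g = 1)
    (hp_entropy : 0 < EntropicBound.entropyRate p)
    (I : Set ℕ) (hI : I.Infinite)
    (V : I → Type v) [∀ n, Fintype (V n)] [∀ n, DecidableEq (V n)] [∀ n, MulAction G (V n)]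
    (hV : ∀ n : I, Fintype.card (V n) = (n : ℕ))
    (ε : ℝ) (hε_pos : 0 < ε) (hε_lt : ε < 1) :
    ENNReal.ofReal (1 / EntropicBound.entropyRate p) ≤
      liminf
        (fun n : I => ⨅ x : V n,
          ((EntropicBound.mixingTime p x (1 - ε) : ℕ∞) : ℝ≥0∞) / ENNReal.ofReal (Real.log (n : ℕ)))
        atTop := by
  refine le_of_forall_lt fun b hb => ?_
  -- Passing from `b` to a larger `b'` makes the constant `c` positive even when `b = 0`.
  obtain ⟨b', hbb', hb'⟩ := exists_between hb
  refine hbb'.trans_le ?_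
  lift b' to NNReal using hb'.ne_top
  obtain ⟨c, hcb⟩ : ∃ c : ℝ, c = (b' : ℝ) := ⟨_, rfl⟩
  have hc0 : 0 < c := by
    have : (0 : ℝ≥0∞) < (b' : ℝ≥0∞) := (zero_le (a := b)).trans_lt hbb'
    rw [hcb]
    exact_mod_cast this
  have hc : c < 1 / EntropicBound.entropyRate p := by
    rw [← ENNReal.ofReal_coe_nnreal, ← hcb] at hb'
    exact (ENNReal.ofReal_lt_ofReal_iff (by positivity)).1 hb'
  have hlt : EntropicBound.entropyRate p < 1 / c := by
    rwa [lt_one_div hp_entropy hc0]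
  -- This `h` leaves room on both sides: it exceeds the entropy rate, and `c * h < 1` makes the
  -- decay exponent `s * (1 - c * h)` positive.
  obtain ⟨h, hh, hhc⟩ := exists_between hlt
  have hh0 : 0 < h := hp_entropy.trans hh
  have hhc' : 0 < 1 - c * h := by
    rw [lt_div_iff₀ hc0] at hhc
    linarith
  obtain ⟨s, C, hs0, hs1, hC, hbound⟩ :=
    EntropicBound.exists_powerSum_walkLaw_le hp_nonneg hp_sum hh hh0.le
  have hcoe : Tendsto (fun n : I => (n : ℕ)) atTop atTop := by
    refine tendsto_atTop_atTop_of_monotone (fun _ _ hab => hab) fun N => ?_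
    obtain ⟨n, hn, hNn⟩ := hI.exists_gt N
    exact ⟨⟨n, hn⟩, hNn.le⟩
  have hdecay : Tendsto (fun n : ℕ => C * Real.exp (-(s * (1 - c * h) * Real.log n))) atTop
      (𝓝 0) := by
    have h1 : Tendsto (fun n : ℕ => s * (1 - c * h) * Real.log n) atTop atTop :=
      (Real.tendsto_log_atTop.comp tendsto_natCast_atTop_atTop).const_mul_atTop
        (mul_pos hs0 hhc')
    simpa using (Real.tendsto_exp_neg_atTop_nhds_zero.comp h1).const_mul C
  refine le_liminf_of_le (by isBoundedDefault) ?_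
  filter_upwards [hcoe.eventually (hdecay.eventually (gt_mem_nhds hε_pos)),
    hcoe.eventually (eventually_ge_atTop 2)] with n hn hn2
  have hn2' : (1 : ℝ) < (n : ℕ) := by exact_mod_cast hn2
  have hlog : 0 < Real.log (n : ℕ) := Real.log_pos hn2'
  refine le_iInf fun x => ?_
  rw [ENNReal.le_div_iff_mul_le (Or.inl (by simpa using hlog)) (Or.inl ENNReal.ofReal_ne_top),
    ← ENNReal.ofReal_coe_nnreal, ← hcb, ← ENNReal.ofReal_mul hc0.le]
  by_contra hcon
  rw [not_le] at hcon
  have hfin : EntropicBound.mixingTime p x (1 - ε) ≠ ⊤ := by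
    intro htop
    simp [htop] at hcon
  obtain ⟨T, hT⟩ := ENat.ne_top_iff_exists.1 hfin
  rw [← hT] at hcon
  have hTc : (T : ℝ) < c * Real.log (n : ℕ) := by
    have : ENNReal.ofReal (T : ℝ) < ENNReal.ofReal (c * Real.log (n : ℕ)) := by
      simpa using hcon
    exact (ENNReal.ofReal_lt_ofReal_iff (by positivity)).1 this
  obtain ⟨t, ht, htT⟩ : ∃ t : ℕ, EntropicBound.distToUniform p x t < 1 - ε ∧ t ≤ T := by
    -- The strict bound by `T + 1` extracts from the infimum an actual time `t ≤ T`.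
    have hlt : EntropicBound.mixingTime p x (1 - ε) < ((T + 1 : ℕ) : ℕ∞) := by
      rw [← hT]
      exact_mod_cast Nat.lt_succ_self T
    simp only [EntropicBound.mixingTime, iInf_lt_iff] at hlt
    obtain ⟨t, ht, htT⟩ := hlt
    exact ⟨t, ht, Nat.lt_succ_iff.1 (by exact_mod_cast htT)⟩
  have htc : (t : ℝ) ≤ c * Real.log (n : ℕ) := (Nat.cast_le.2 htT).trans hTc.le
  have hdist := EntropicBound.one_sub_le_distToUniform hp_nonneg hp_sum x t hs0.le hs1
  rw [hV] at hdist
  have hpow : (1 / ((n : ℕ) : ℝ)) ^ s = Real.exp (-(s * Real.log (n : ℕ))) := by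
    rw [Real.rpow_def_of_pos (by positivity), one_div, Real.log_inv]
    ring_nf
  have hmain : (1 / ((n : ℕ) : ℝ)) ^ s *
      EntropicBound.powerSum (1 - s) (EntropicBound.walkLaw p t) < ε := by
    refine lt_of_le_of_lt ?_ hn
    calc _ ≤ Real.exp (-(s * Real.log (n : ℕ))) * (C * Real.exp (s * (t * h))) := by
          rw [hpow]
          exact mul_le_mul_of_nonneg_left (hbound t) (Real.exp_pos _).le
      _ = C * Real.exp (s * (t * h) - s * Real.log (n : ℕ)) := by
          rw [mul_left_comm, ← Real.exp_add]
          ring_nf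
      _ ≤ C * Real.exp (-(s * (1 - c * h) * Real.log (n : ℕ))) := by
          refine mul_le_mul_of_nonneg_left (Real.exp_le_exp.2 ?_) hC
          have := mul_le_mul_of_nonneg_left (mul_le_mul_of_nonneg_right htc hh0.le) hs0.le
          linarith
  linarith
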